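/- For a positive integer $n$ let $[n]_q = 1+q+\cdots+q^{n-1}$. For multisets of integers of the same size, written in increasing order as $B=\{b_1\le\cdots\le b_m\}$ and $A=\{a_1\le\cdots\le a_m\}$, write $B\preceq A$ (Gale order) if $b_k\le a_k$ for all $k$. Let $\Phi^+$ be the multiplicative monoid of basic cyclotomic generating functions, i.e. of polynomials with nonnegative integer coefficients of the form $f(q)=\prod_{k=1}^m [a_k]_q/\prod_{k=1}^m [b_k]_q$ with $m\ge 0$ and $a_k,b_k$ positive integers, and let $\Phi^{\mathrm{Gale}}\subseteq\Phi^+$ be the submonoid of those $f$ that have such an expression with $\{b_1,\dots,b_m\}\preceq\{a_1,\dots,a_m\}$. Let $\Bbbk$ be a field. For $m\ge0$, grade $\Bbbk[x_1,\dots,x_m]$ by $\deg x_j=b_j$ with $b_j$ positive integers, let $\theta_1,\dots,\theta_m$ be homogeneous polynomials of positive degrees $\deg\theta_j=a_j$ (as many as there are variables), and put $R=\Bbbk[x_1,\dots,x_m]/(\theta_1,\dots,\theta_m)$ and $\mathrm{Hilb}(R;q)=\sum_{n\ge0}(\dim_{\Bbbk} R_n)\,q^n$. The sequence $\theta_1,\dots,\theta_m$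 is regular if $\theta_i$ is not a zero divisor in $\Bbbk[x_1,\dots,x_m]/(\theta_1,\dots,\theta_{i-1})$ for each $i$, and it is a homogeneous system of parameters (HSOP) if $\Bbbk[x_1,\dots,x_m]$ is a finitely generated $\Bbbk[\theta_1,\dots,\theta_m]$-module. Let $\Phi^{\mathrm{alg}}$ be the set of all Hilbert series $\mathrm{Hilb}(R;q)$ of such quotients $R$ by homogeneous systems of parameters (for all $m$ and all degrees, over the fixed field $\Bbbk$). **Lemma.** 1. Every element of $\Phi^{\mathrm{alg}}$ is a polynomial, and $\Phi^{\mathrm{alg}}$ is a submonoid of the Gale monoid $\Phi^{\mathrm{Gale}}$ under multiplication. 2. If $\theta_1,\dots,\theta_m$ as above is a regular sequence or a homogeneous system of parameters, then $\mathrm{Hilb}(R;q)\in\Phi^{\mathrm{Gale}}$ and $\{b_1,\dots,b_m\}\preceq\{a_1,\dots,a_m\}$; that is, when both lists of degrees are sorted increasingly, $a_k\ge b_k$ for all $k=1,\dots,m$. -/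

import Mathlib

open Polynomial

/-! ### Gale order on multisets -/

/-- Gale order `A ≼ B` on multisets of natural numbers: the two multisets have the same size and,
once both are sorted increasingly, the `k`-th entry of `A` is at most the `k`-th entry of `B`
for every `k`. (`List.Forall₂` forces the two lists to have equal length.) -/
def GaleLE (A B : Multiset ℕ) : Prop :=
  List.Forall₂ (fun a b : ℕ => a ≤ b) A.sort B.sort

theorem forall₂_orderedInsert {a b : ℕ} (hab : a ≤ b) {l₁ l₂ : List ℕ}
    (h : List.Forall₂ (fun a b : ℕ => a ≤ b) l₁ l₂)
    (s₁ : l₁.Pairwise (· ≤ ·)) (s₂ : l₂.Pairwise (· ≤ ·)) :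
    List.Forall₂ (fun a b : ℕ => a ≤ b) (l₁.orderedInsert (· ≤ ·) a)
      (l₂.orderedInsert (· ≤ ·) b) := by
  induction h generalizing a b with
  | nil => simpa using hab
  | @cons x y t₁ t₂ hxy ht ih =>
    have st₁ := s₁.of_cons
    have st₂ := s₂.of_cons
    have e₁ : t₁.orderedInsert (· ≤ ·) x = x :: t₁ := by
      have := List.Pairwise.insertionSort_eq s₁
      rwa [List.insertionSort_cons, List.Pairwise.insertionSort_eq st₁] at this
    have e₂ : t₂.orderedInsert (· ≤ ·) y = y :: t₂ := by
      have := List.Pairwise.insertionSort_eq s₂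
      rwa [List.insertionSort_cons, List.Pairwise.insertionSort_eq st₂] at this
    simp only [List.orderedInsert_cons]
    split_ifs with h₁ h₂ h₂
    · exact .cons hab (.cons hxy ht)
    · refine .cons (h₁.trans hxy) ?_
      rw [← e₁]
      exact ih (by omega) st₁ st₂
    · refine .cons (by omega) ?_
      rw [← e₂]
      exact ih (by omega) st₁ st₂
    · exact .cons hxy (ih hab st₁ st₂)

theorem forall₂_insertionSort {l₁ l₂ : List ℕ}
    (h : List.Forall₂ (fun a b : ℕ => a ≤ b) l₁ l₂) :
    List.Forall₂ (fun a b : ℕ => a ≤ b) (l₁.insertionSort (· ≤ ·))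
      (l₂.insertionSort (· ≤ ·)) := by
  induction h with
  | nil => simp
  | cons hab _ ih =>
    simp only [List.insertionSort_cons]
    exact forall₂_orderedInsert hab ih (List.pairwise_insertionSort _ _)
      (List.pairwise_insertionSort _ _)

theorem sort_add_eq (A C : Multiset ℕ) :
    (A + C).sort = (A.sort ++ C.sort).insertionSort (· ≤ ·) := by
  have h : A + C = ((A.sort ++ C.sort : List ℕ) : Multiset ℕ) := by
    rw [← Multiset.coe_add, Multiset.sort_eq, Multiset.sort_eq]
  conv_lhs => rw [h]
  rw [Multiset.coe_sort, List.mergeSort_eq_insertionSort]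

theorem GaleLE.add {A B C D : Multiset ℕ} (h₁ : GaleLE A B) (h₂ : GaleLE C D) :
    GaleLE (A + C) (B + D) := by
  unfold GaleLE at *
  rw [sort_add_eq, sort_add_eq]
  exact forall₂_insertionSort (List.rel_append h₁ h₂)

/-! ### Cyclotomic generating functions -/

/-- The `q`-integer `[n]_q = 1 + q + ⋯ + q ^ (n - 1)`. -/
noncomputable def qInt (n : ℕ) : ℤ[X] := ∑ i ∈ Finset.range n, X ^ i

/-- `f = ∏_{a ∈ A} [a]_q / ∏_{b ∈ B} [b]_q`, where `A` and `B` are multisets of positive integers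
of the same size. -/
structure IsRationalForm (f : ℤ[X]) (A B : Multiset ℕ) : Prop where
  card_eq : A.card = B.card
  num_pos : ∀ a ∈ A, 0 < a
  den_pos : ∀ b ∈ B, 0 < b
  eq : f * (B.map qInt).prod = (A.map qInt).prod

theorem isRationalForm_one : IsRationalForm 1 0 0 := ⟨rfl, by simp, by simp, by simp⟩

theorem IsRationalForm.mul {f g : ℤ[X]} {A B C D : Multiset ℕ} (hf : IsRationalForm f A B)
    (hg : IsRationalForm g C D) : IsRationalForm (f * g) (A + C) (B + D) where
  card_eq := by simp [hf.card_eq, hg.card_eq]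
  num_pos a ha := (Multiset.mem_add.1 ha).elim (hf.num_pos a) (hg.num_pos a)
  den_pos b hb := (Multiset.mem_add.1 hb).elim (hf.den_pos b) (hg.den_pos b)
  eq := by
    rw [Multiset.map_add, Multiset.prod_add, Multiset.map_add, Multiset.prod_add, ← hf.eq, ← hg.eq]
    ring

theorem coeff_mul_nonneg {f g : ℤ[X]} (hf : ∀ n, 0 ≤ f.coeff n) (hg : ∀ n, 0 ≤ g.coeff n)
    (n : ℕ) : 0 ≤ (f * g).coeff n := by
  rw [Polynomial.coeff_mul]
  exact Finset.sum_nonneg fun x _ => mul_nonneg (hf x.1) (hg x.2)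

theorem coeff_one_nonneg (n : ℕ) : 0 ≤ (1 : ℤ[X]).coeff n := by
  rw [Polynomial.coeff_one]
  split_ifs <;> simp

/-- The monoid `Φ⁺` of basic cyclotomic generating functions: polynomials with nonnegative integer
coefficients that are quotients of products of equally many `q`-integers. -/
noncomputable def basicCGFMonoid : Submonoid ℤ[X] where
  carrier := {f | (∀ n, 0 ≤ f.coeff n) ∧ ∃ A B : Multiset ℕ, IsRationalForm f A B}
  one_mem' := ⟨coeff_one_nonneg, 0, 0, isRationalForm_one⟩
  mul_mem' := by
    rintro f g ⟨hf, A, B, hAB⟩ ⟨hg, C, D, hCD⟩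
    exact ⟨coeff_mul_nonneg hf hg, A + C, B + D, hAB.mul hCD⟩

/-- The Gale monoid: the basic cyclotomic generating functions
`f = ∏_{a ∈ A} [a]_q / ∏_{b ∈ B} [b]_q` such that `B ≼ A` in Gale order. -/
noncomputable def galeMonoid : Submonoid ℤ[X] where
  carrier := {f | f ∈ basicCGFMonoid ∧
    ∃ A B : Multiset ℕ, IsRationalForm f A B ∧ GaleLE B A}
  one_mem' := ⟨basicCGFMonoid.one_mem, 0, 0, isRationalForm_one, by simp [GaleLE]⟩
  mul_mem' := by
    rintro f g ⟨hf, A, B, hAB, h₁⟩ ⟨hg, C, D, hCD, h₂⟩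
    exact ⟨basicCGFMonoid.mul_mem hf hg, A + C, B + D, hAB.mul hCD, h₁.add h₂⟩

/-! ### Weighted polynomial rings and their quotients -/

section Weighted

variable {k : Type*} [Field k] {m : ℕ}

/-- `θ₁, …, θₘ` are homogeneous polynomials of positive degrees `a₁, …, aₘ` in
`k[x₁, …, xₘ]`, graded by `deg xⱼ = bⱼ` with every `bⱼ` positive. -/
structure IsHomogeneousSystem (b a : Fin m → ℕ) (θ : Fin m → MvPolynomial (Fin m) k) : Prop where
  weight_pos : ∀ j, 0 < b j
  degree_pos : ∀ j, 0 < a j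
  homogeneous : ∀ j, MvPolynomial.IsWeightedHomogeneous b (θ j) (a j)

/-- `k[x₁, …, xₘ]` is a finitely generated module over its subalgebra `k[θ₁, …, θₘ]`. For
homogeneous `θ` this says that `θ` is a homogeneous system of parameters. -/
def IsParameterSystem (θ : Fin m → MvPolynomial (Fin m) k) : Prop :=
  Module.Finite (Algebra.adjoin k (Set.range θ)) (MvPolynomial (Fin m) k)

/-- `θᵢ` is not a zero divisor in `k[x₁, …, xₘ] / (θ₁, …, θᵢ₋₁)`, for every `i`. (For homogeneous
`θ` of positive degrees, `k[x₁, …, xₘ] / (θ₁, …, θₘ)` is automatically nonzero.) -/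
def IsRegularSystem (θ : Fin m → MvPolynomial (Fin m) k) : Prop :=
  RingTheory.Sequence.IsWeaklyRegular (MvPolynomial (Fin m) k) (List.ofFn θ)

/-- The degree `n` part of `R = k[x₁, …, xₘ] / (θ₁, …, θₘ)`: the classes of the homogeneous
polynomials of degree `n`. -/
noncomputable def gradedPiece (b : Fin m → ℕ) (θ : Fin m → MvPolynomial (Fin m) k) (n : ℕ) :
    Submodule k (MvPolynomial (Fin m) k ⧸ Ideal.span (Set.range θ)) :=
  (MvPolynomial.weightedHomogeneousSubmodule k b n).map
    (Ideal.Quotient.mkₐ k (Ideal.span (Set.range θ))).toLinearMap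

/-- The Hilbert series `∑ₙ (dim Rₙ) qⁿ` of `R = k[x₁, …, xₘ] / (θ₁, …, θₘ)`. -/
noncomputable def hilbertSeries (b : Fin m → ℕ) (θ : Fin m → MvPolynomial (Fin m) k) :
    PowerSeries ℤ :=
  PowerSeries.mk fun n => (Module.finrank k (gradedPiece b θ n) : ℤ)

end Weighted

/-- The set of all Hilbert series of quotients `k[x₁, …, xₘ] / (θ₁, …, θₘ)`, where `m ≥ 0`, the
variables have arbitrary positive integer degrees and `θ₁, …, θₘ` is a homogeneous system of
parameters. -/
def hsopHilbertSeries (k : Type*) [Field k] : Set (PowerSeries ℤ) :=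
  {F | ∃ (m : ℕ) (b a : Fin m → ℕ) (θ : Fin m → MvPolynomial (Fin m) k),
    IsHomogeneousSystem b a θ ∧ IsParameterSystem θ ∧ F = hilbertSeries b θ}

/-! ### Systems of parameters on Cohen–Macaulay modules over local rings -/

section CohenMacaulay

open IsLocalRing RingTheory.Sequence Pointwise

universe u

variable {R : Type u} [CommRing R] [IsLocalRing R] [IsNoetherianRing R]

/-! For homogeneous `θ` of positive degrees, being a regular sequence and being a system of
parameters are equivalent, and each side supplies half of the result.

An HSOP is regular (`IsParameterSystem.isRegularSystem`) because the polynomial ring localized at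
the origin is Cohen–Macaulay: the variables are a regular sequence of length `m`, so every
associated prime has a quotient of dimension at least `m`, and Krull's height theorem forbids a
parameter to lie in one. Homogeneity brings regularity back from the localization.

Regularity determines the Hilbert series: dividing by a nonzerodivisor of degree `d` multiplies it
by `1 - q ^ d`. Applied to `θ` and to the variables, this gives `∏ [a_j]_q / ∏ [b_j]_q`, whose
coefficients are nonnegative and bounded by those of the numerator, hence a polynomial. So the
quotient vanishes in large degrees, and graded Nakayama makes a regular sequence an HSOP
(`IsRegularSystem.isParameterSystem`).

The Gale inequalities (`IsParameterSystem.card_filter_le`) follow by killing all variables of degree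
at most `t`. This kills every `θ_j` of degree at most `t`, so comparing transcendence degrees shows
that at least as many `a_j` as `b_i` exceed `t`. Products come from concatenating systems in
disjoint variables. -/

theorem ringKrullDim_quotient_succ_le {S : Type*} [CommRing S] {p q : Ideal S} [p.IsPrime]
    (hpq : p ≤ q) {x : S} (hxp : x ∉ p) (hxq : x ∈ q) :
    ringKrullDim (S ⧸ q) + 1 ≤ ringKrullDim (S ⧸ p) := by
  have hx : Ideal.Quotient.mk p x ∈ nonZeroDivisors (S ⧸ p) := by
    rw [mem_nonZeroDivisors_iff_ne_zero, Ne, Ideal.Quotient.eq_zero_iff_mem]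
    exact hxp
  refine le_trans ?_ (ringKrullDim_quotient_succ_le_of_nonZeroDivisor hx)
  gcongr
  -- `S ⧸ q` is a quotient of `(S ⧸ p) ⧸ (x)`, as `q` contains both `p` and `x`.
  refine ringKrullDim_le_of_surjective
    (Ideal.Quotient.lift (Ideal.span {Ideal.Quotient.mk p x}) (Ideal.Quotient.factor hpq) ?_) ?_
  · intro a ha
    rw [← RingHom.mem_ker]
    refine (Ideal.span_le.2 ?_ : Ideal.span {Ideal.Quotient.mk p x} ≤ _) ha
    rw [Set.singleton_subset_iff, SetLike.mem_coe, RingHom.mem_ker, Ideal.Quotient.factor_mk,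
      Ideal.Quotient.eq_zero_iff_mem]
    exact hxq
  · exact Ideal.Quotient.lift_surjective_of_surjective _ _ (Ideal.Quotient.factor_surjective hpq)

/-- The `p`-torsion `N` of `M` is nonzero. If it lay in `xM`, regularity of `x` would give `N = xN`,
contradicting Nakayama. So some element of `N` survives in `M / xM`, and its class is killed by both
`p` and `x`. -/
theorem exists_isAssociatedPrime_quotSMulTop {M : Type*} [AddCommGroup M] [Module R M]
    [Module.Finite R M] {x : R} (hx : x ∈ maximalIdeal R) (hreg : IsSMulRegular M x)
    {p : Ideal R} (hp : IsAssociatedPrime p M) :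
    ∃ q, IsAssociatedPrime q (QuotSMulTop x M) ∧ p ≤ q ∧ x ∈ q := by
  set N : Submodule R M := Submodule.torsionBySet R M p with hN
  obtain ⟨-, m, hm⟩ := isAssociatedPrime_iff.1 hp
  have hmN : m ∈ N := by
    rw [hN, Submodule.mem_torsionBySet_iff]
    rintro ⟨a, ha⟩
    rw [SetLike.mem_coe, hm, Submodule.mem_colon_singleton, Submodule.mem_bot] at ha
    exact ha
  have hm0 : m ≠ 0 := by
    rintro rfl
    exact hp.1.ne_top (by rw [hm]; ext; simp [Submodule.mem_colon_singleton])
  have hNx : ¬ N ≤ x • (⊤ : Submodule R M) := by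
    intro hle
    have : N = ⊥ := by
      refine Submodule.eq_bot_of_le_smul_of_le_jacobson_bot (Ideal.span {x}) N
        (IsNoetherian.noetherian N) ?_ ?_
      · intro y hy
        obtain ⟨z, -, rfl⟩ := (Submodule.mem_smul_pointwise_iff_exists _ _ _).1 (hle hy)
        refine Submodule.smul_mem_smul (Ideal.mem_span_singleton_self x) ?_
        rw [hN, Submodule.mem_torsionBySet_iff] at hy ⊢
        intro a
        apply hreg
        have := hy a
        simp only [smul_zero]
        rw [smul_comm]
        exact this
      · rw [IsLocalRing.jacobson_eq_maximalIdeal _ bot_ne_top, Ideal.span_singleton_le_iff_mem]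
        exact hx
    rw [this, Submodule.mem_bot] at hmN
    exact hm0 hmN
  obtain ⟨y, hyN, hy⟩ := SetLike.not_le_iff_exists.1 hNx
  have hy0 : (Submodule.Quotient.mk y : QuotSMulTop x M) ≠ 0 := by
    rwa [Ne, Submodule.Quotient.mk_eq_zero]
  obtain ⟨q, hq, hle⟩ := exists_le_isAssociatedPrime_of_isNoetherianRing R _ hy0
  refine ⟨q, hq, fun a ha => hle ?_, hle ?_⟩
  · rw [Submodule.mem_colon_singleton, Submodule.mem_bot, ← Submodule.Quotient.mk_smul]
    rw [hN, Submodule.mem_torsionBySet_iff] at hyN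
    rw [hyN ⟨a, ha⟩, Submodule.Quotient.mk_zero]
  · rw [Submodule.mem_colon_singleton, Submodule.mem_bot, ← Submodule.Quotient.mk_smul,
      Submodule.Quotient.mk_eq_zero]
    exact Submodule.smul_mem_pointwise_smul _ _ _ trivial

/-- Each regular element enlarges the associated prime strictly, since a regular element avoids
every associated prime; so the dimension drops at each step. -/
theorem length_le_ringKrullDim_quotient_of_isAssociatedPrime (rs : List R) {M : Type*}
    [AddCommGroup M] [Module R M] [Module.Finite R M] (hrs : IsWeaklyRegular M rs)
    (hmem : ∀ r ∈ rs, r ∈ maximalIdeal R) {p : Ideal R} (hp : IsAssociatedPrime p M) :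
    (rs.length : WithBot ℕ∞) ≤ ringKrullDim (R ⧸ p) := by
  induction rs generalizing M p with
  | nil =>
    have := Ideal.Quotient.nontrivial_iff.2 hp.1.ne_top
    simpa using ringKrullDim_nonneg_of_nontrivial (R := R ⧸ p)
  | cons x xs ih =>
    rw [isWeaklyRegular_cons_iff] at hrs
    obtain ⟨q, hq, hpq, hxq⟩ := exists_isAssociatedPrime_quotSMulTop (hmem x (by simp)) hrs.1 hp
    have hxp : x ∉ p := by
      intro hxp
      have : x ∈ ⋃ p ∈ associatedPrimes R M, (p : Set R) := Set.mem_biUnion hp hxp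
      rw [biUnion_associatedPrimes_eq_compl_regular] at this
      exact this hrs.1
    have := hp.1
    refine le_trans ?_ (ringKrullDim_quotient_succ_le hpq hxp hxq)
    rw [List.length_cons, Nat.cast_add, Nat.cast_one]
    gcongr
    exact ih hrs.2 (fun r hr => hmem r (List.mem_cons_of_mem _ hr)) hq

open CategoryTheory Abelian in
-- Depth drops by at most one. Regular sequences of a given length are detected by vanishing of Ext
-- below that length, and the long exact sequence of `0 → M → M → M / xM → 0` loses one degree.
theorem exists_isRegular_quotSMulTop {M : Type u} [AddCommGroup M] [Module R M]
    [Module.Finite R M] {rs : List R} (hrs : IsRegular M rs) (hmem : ∀ r ∈ rs, r ∈ maximalIdeal R)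
    {n : ℕ} (hn : rs.length = n + 1) {x : R} (hx : x ∈ maximalIdeal R)
    (hreg : IsSMulRegular M x) :
    ∃ rs' : List R, rs'.length = n ∧ (∀ r ∈ rs', r ∈ maximalIdeal R) ∧
      IsRegular (QuotSMulTop x M) rs' := by
  have := hrs.nontrivial
  have := nontrivial_quotSMulTop_of_mem_maximalIdeal (L := M) hx
  have lt (N : Type u) [AddCommGroup N] [Module R N] [Module.Finite R N] [Nontrivial N] :
      maximalIdeal R • (⊤ : Submodule R N) < ⊤ :=
    (Submodule.top_ne_ideal_smul_of_le_jacobson_annihilator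
      (maximalIdeal_le_jacobson _)).symm.lt_top
  have h₁ := ((ModuleCat.exists_isRegular_tfae (maximalIdeal R) (n + 1) (ModuleCat.of R M)
    (lt M)).out 1 3 rfl rfl).2 ⟨rs, hn, hmem, hrs⟩
  refine ((ModuleCat.exists_isRegular_tfae (maximalIdeal R) n
    (ModuleCat.of R (QuotSMulTop x M)) (lt _)).out 1 3 rfl rfl).1 fun i hi => ?_
  have zero1 := AddCommGrpCat.isZero_of_iff_subsingleton.mpr (h₁ i (by omega))
  have zero2 := AddCommGrpCat.isZero_of_iff_subsingleton.mpr (h₁ (i + 1) (by omega))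
  exact AddCommGrpCat.subsingleton_of_isZero <| ShortComplex.Exact.isZero_of_both_zeros
    ((Ext.covariant_sequence_exact₃' _
      (IsSMulRegular.smulShortComplex_shortExact (M := ModuleCat.of R M) hreg)) i (i + 1) rfl)
    (zero1.eq_zero_of_src _) (zero2.eq_zero_of_tgt _)

/-- If `M` has a regular sequence as long as `θ`, and `θ` is a system of parameters on `M`, then
`θ` is a regular sequence on `M`. -/
theorem isWeaklyRegular_of_forall_isPrime_eq_maximalIdeal (θ : List R) {M : Type u}
    [AddCommGroup M] [Module R M] [Module.Finite R M] {rs : List R} (hrs : IsRegular M rs)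
    (hmem : ∀ r ∈ rs, r ∈ maximalIdeal R) (hlen : rs.length = θ.length)
    (hθ : ∀ t ∈ θ, t ∈ maximalIdeal R)
    (hsop : ∀ q : Ideal R, q.IsPrime → Module.annihilator R M ≤ q → (∀ t ∈ θ, t ∈ q) →
      q = maximalIdeal R) :
    IsWeaklyRegular M θ := by
  induction θ generalizing M rs with
  | nil => exact .nil R M
  | cons t ts ih =>
    have htm := hθ t (by simp)
    have ht : IsSMulRegular M t := by
      by_contra hcon
      have : t ∈ ⋃ p ∈ associatedPrimes R M, (p : Set R) := by
        rw [biUnion_associatedPrimes_eq_compl_regular]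
        exact hcon
      obtain ⟨p, hp, htp⟩ := Set.mem_iUnion₂.1 this
      have hdim := length_le_ringKrullDim_quotient_of_isAssociatedPrime rs hrs.1 hmem hp
      have hpp : p.IsPrime := hp.1
      have := Ideal.Quotient.nontrivial_iff.2 hpp.ne_top
      have : IsLocalRing (R ⧸ p) := .of_surjective' _ Ideal.Quotient.mk_surjective
      have : IsLocalHom (Ideal.Quotient.mk p) :=
        Function.Surjective.isLocalHom _ Ideal.Quotient.mk_surjective
      classical
      -- Since `t` dies in `R ⧸ p`, the remaining `ts` alone cut out the closed point there, so
      -- Krull bounds the dimension by `ts.length`, one less than `hdim` requires.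
      have hmin : maximalIdeal (R ⧸ p) ∈
          (Ideal.span ((ts.map (Ideal.Quotient.mk p)).toFinset : Set (R ⧸ p))).minimalPrimes := by
        refine ⟨⟨inferInstance, ?_⟩, ?_⟩
        · rw [Ideal.span_le]
          intro a ha
          simp only [List.coe_toFinset, List.mem_map, Set.mem_ofPred_eq] at ha
          obtain ⟨s, hs, rfl⟩ := ha
          have := hθ s (by simp [hs])
          rw [mem_maximalIdeal, mem_nonunits_iff] at this
          rw [SetLike.mem_coe, mem_maximalIdeal, mem_nonunits_iff]
          exact fun h => this (isUnit_of_map_unit (Ideal.Quotient.mk p) s h)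
        · rintro Q ⟨hQ, hspan⟩ -
          have hcomap : Q.comap (Ideal.Quotient.mk p) = maximalIdeal R := by
            have hpQ : p ≤ Q.comap (Ideal.Quotient.mk p) := fun a ha => by
              rw [Ideal.mem_comap, Ideal.Quotient.eq_zero_iff_mem.2 ha]
              exact Q.zero_mem
            refine hsop _ inferInstance (le_trans ?_ hpQ) ?_
            · rw [← Submodule.annihilator_top]
              exact hp.annihilator_le
            · intro s hs
              rcases List.mem_cons.1 hs with rfl | hs
              · exact hpQ htp
              · refine hspan (Ideal.subset_span ?_)
                simp only [List.coe_toFinset, List.mem_map, Set.mem_ofPred_eq]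
                exact ⟨s, hs, rfl⟩
          intro a ha
          obtain ⟨b, rfl⟩ := Ideal.Quotient.mk_surjective a
          have hb : b ∈ maximalIdeal R := by
            rw [mem_maximalIdeal, mem_nonunits_iff] at ha ⊢
            exact fun h => ha (h.map _)
          rw [← hcomap] at hb
          exact hb
      have hht := Ideal.height_le_card_of_mem_minimalPrimes_span_finset hmin
      rw [← maximalIdeal_height_eq_ringKrullDim] at hdim
      have h1 : rs.length ≤ (ts.map (Ideal.Quotient.mk p)).toFinset.card := by
        have h2 : ((rs.length : ℕ∞) : WithBot ℕ∞) ≤ ((maximalIdeal (R ⧸ p)).height : WithBot ℕ∞) :=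
          hdim
        exact_mod_cast (WithBot.coe_le_coe.1 h2).trans hht
      have h2 := List.toFinset_card_le (ts.map (Ideal.Quotient.mk p))
      rw [List.length_map] at h2
      rw [List.length_cons] at hlen
      omega
    obtain ⟨rs', hlen', hmem', hrs'⟩ := exists_isRegular_quotSMulTop hrs hmem hlen htm ht
    refine .cons ht (ih hrs' hmem' hlen' (fun s hs => hθ s (by simp [hs])) ?_)
    intro q hq hann hts
    have htann : t ∈ Module.annihilator R (QuotSMulTop t M) := by
      rw [Module.mem_annihilator]
      intro m
      obtain ⟨m, rfl⟩ := Submodule.Quotient.mk_surjective _ m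
      rw [← Submodule.Quotient.mk_smul, Submodule.Quotient.mk_eq_zero]
      exact Submodule.smul_mem_pointwise_smul _ _ _ trivial
    refine hsop q hq (le_trans ?_ hann) ?_
    · exact (Submodule.mkQ (t • (⊤ : Submodule R M))).annihilator_le_of_surjective
        (Submodule.mkQ_surjective _)
    · intro s hs
      rcases List.mem_cons.1 hs with rfl | hs
      · exact hann htann
      · exact hts s hs

end CohenMacaulay

/-! ### Homogeneous systems of parameters are regular sequences -/

section Regular

open RingTheory.Sequence

theorem ofList_take_ofFn {S : Type*} [CommRing S] {m : ℕ} (θ : Fin m → S) (i : Fin m) :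
    Ideal.ofList ((List.ofFn θ).take i) = Ideal.span (θ '' Set.Iio i) := by
  rw [Ideal.ofList]
  congr 1
  ext x
  simp only [Set.mem_ofPred_eq, Set.mem_image, Set.mem_Iio, List.mem_take_iff_getElem,
    List.length_ofFn, List.getElem_ofFn]
  constructor
  · rintro ⟨j, hj, rfl⟩
    exact ⟨⟨j, by omega⟩, Fin.lt_def.2 (by simp; omega), rfl⟩
  · rintro ⟨j, hj, rfl⟩
    exact ⟨j, by have := Fin.lt_def.1 hj; omega, rfl⟩

theorem isWeaklyRegular_ofFn_iff {S : Type*} [CommRing S] {m : ℕ} (θ : Fin m → S) :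
    IsWeaklyRegular S (List.ofFn θ) ↔
      ∀ i f, f * θ i ∈ Ideal.span (θ '' Set.Iio i) → f ∈ Ideal.span (θ '' Set.Iio i) := by
  have key (i : Fin m) : IsSMulRegular (S ⧸ (Ideal.ofList ((List.ofFn θ).take i) • ⊤ : Ideal S))
      (θ i) ↔ ∀ f, f * θ i ∈ Ideal.span (θ '' Set.Iio i) → f ∈ Ideal.span (θ '' Set.Iio i) := by
    rw [isSMulRegular_quotient_iff_mem_of_smul_mem, smul_eq_mul, Ideal.mul_top, ofList_take_ofFn]
    simp only [smul_eq_mul, mul_comm]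
  rw [isWeaklyRegular_iff]
  constructor
  · intro h i
    rw [← key i]
    simpa using h i (by simp)
  · intro h i hi
    rw [List.length_ofFn] at hi
    simpa using (key ⟨i, hi⟩).2 (h ⟨i, hi⟩)

variable {k : Type*} [Field k] {m : ℕ} {b a : Fin m → ℕ} {θ : Fin m → MvPolynomial (Fin m) k}

theorem isWeaklyRegular_X : IsWeaklyRegular (MvPolynomial (Fin m) k)
    (List.ofFn (MvPolynomial.X : Fin m → MvPolynomial (Fin m) k)) := by
  rw [isWeaklyRegular_ofFn_iff]
  intro i f hf
  rw [MvPolynomial.mem_ideal_span_X_image] at hf ⊢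
  intro d hd
  obtain ⟨j, hj, hne⟩ := hf (d + Finsupp.single i 1) (by
    rw [MvPolynomial.mem_support_iff] at hd ⊢
    rwa [MvPolynomial.coeff_mul_X])
  refine ⟨j, hj, ?_⟩
  have hij : i ≠ j := fun h => by simp [h] at hj
  simpa [Finsupp.single_apply, hij] using hne

/-! ### Homogeneous components in a weighted grading -/

section Components

variable {σ : Type*} {w : σ → ℕ} {φ ψ : MvPolynomial σ k} {d n : ℕ}

theorem weightedHomogeneousComponent_mul_of_right (hψ : ψ.IsWeightedHomogeneous w d) :
    MvPolynomial.weightedHomogeneousComponent w n (φ * ψ) =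
      if d ≤ n then MvPolynomial.weightedHomogeneousComponent w (n - d) φ * ψ else 0 := by
  induction φ using MvPolynomial.induction_on' with
  | monomial e c =>
    have he := MvPolynomial.isWeightedHomogeneous_monomial w e c rfl
    rw [MvPolynomial.weightedHomogeneousComponent_of_mem (he.mul hψ),
      MvPolynomial.weightedHomogeneousComponent_of_mem he]
    split_ifs <;> first | omega | simp
  | add p q hp hq =>
    rw [add_mul, map_add, hp, hq, map_add]
    split_ifs
    · rw [add_mul]
    · rw [add_zero]

theorem weightedHomogeneousComponent_mul_same (hψ : ψ.IsWeightedHomogeneous w d)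
    (hw : ∀ i, 0 < w i) :
    MvPolynomial.weightedHomogeneousComponent w d (φ * ψ) =
      MvPolynomial.C (MvPolynomial.constantCoeff φ) * ψ := by
  rw [weightedHomogeneousComponent_mul_of_right hψ, if_pos le_rfl, Nat.sub_self]
  congr 1
  exact MvPolynomial.weightedHomogeneousComponent_zero _ fun i => (hw i).ne'

attribute [local instance] MvPolynomial.weightedGradedAlgebra in
theorem mem_span_iff_weightedHomogeneousComponent_mem {s : Set (MvPolynomial σ k)}
    (hs : ∀ x ∈ s, ∃ d, x.IsWeightedHomogeneous w d) :
    φ ∈ Ideal.span s ↔ ∀ n, MvPolynomial.weightedHomogeneousComponent w n φ ∈ Ideal.span s :=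
  MvPolynomial.mem_iff_weightedHomogeneousComponent_mem k w
    (Ideal.homogeneous_span (MvPolynomial.weightedHomogeneousSubmodule k w) s hs) φ

theorem constantCoeff_eq_zero_of_isWeightedHomogeneous (hφ : φ.IsWeightedHomogeneous w d)
    (hd : 0 < d) : MvPolynomial.constantCoeff φ = 0 := by
  rw [MvPolynomial.constantCoeff_eq]
  exact hφ.coeff_eq_zero _ (by simpa using hd.ne)

end Components

theorem IsHomogeneousSystem.constantCoeff_eq_zero (hθ : IsHomogeneousSystem b a θ) (j : Fin m) :
    MvPolynomial.constantCoeff (θ j) = 0 :=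
  constantCoeff_eq_zero_of_isWeightedHomogeneous (hθ.homogeneous j) (hθ.degree_pos j)

/-- Modulo an ideal that contains a homogeneous system of parameters, the polynomial ring is
integral over the base field. -/
theorem IsParameterSystem.isIntegral_quotient (hθ : IsParameterSystem θ)
    (h0 : ∀ j, MvPolynomial.constantCoeff (θ j) = 0) {I : Ideal (MvPolynomial (Fin m) k)}
    (hI : ∀ j, θ j ∈ I) : Algebra.IsIntegral k (MvPolynomial (Fin m) k ⧸ I) := by
  unfold IsParameterSystem at hθ
  have hint := Algebra.IsIntegral.of_finite (Algebra.adjoin k (Set.range θ))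
    (MvPolynomial (Fin m) k)
  refine ⟨fun y => ?_⟩
  obtain ⟨f, rfl⟩ := Ideal.Quotient.mk_surjective y
  -- On `k[θ]` the quotient map factors through the constant coefficient, so an integral equation
  -- over `k[θ]` becomes one over `k`.
  refine (hint.isIntegral f).map_of_comp_eq
    ((MvPolynomial.constantCoeff : MvPolynomial (Fin m) k →+* k).comp
      (Algebra.adjoin k (Set.range θ)).val.toRingHom) (Ideal.Quotient.mk I) ?_
  ext ⟨g, hg⟩
  change algebraMap k (MvPolynomial (Fin m) k ⧸ I) (MvPolynomial.constantCoeff g) =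
    Ideal.Quotient.mk I g
  induction hg using Algebra.adjoin_induction with
  | mem x hx =>
    obtain ⟨j, rfl⟩ := hx
    rw [h0, map_zero, Ideal.Quotient.eq_zero_iff_mem.2 (hI j)]
  | algebraMap r =>
    rw [MvPolynomial.algebraMap_eq, MvPolynomial.constantCoeff_C]
    rfl
  | add x y _ _ hx hy => rw [map_add, map_add, map_add, hx, hy]
  | mul x y _ _ hx hy => rw [map_mul, map_mul, map_mul, hx, hy]

theorem IsParameterSystem.isMaximal (hθ : IsParameterSystem θ)
    (h0 : ∀ j, MvPolynomial.constantCoeff (θ j) = 0) {Q : Ideal (MvPolynomial (Fin m) k)}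
    [Q.IsPrime] (hQ : ∀ j, θ j ∈ Q) : Q.IsMaximal := by
  have := hθ.isIntegral_quotient h0 hQ
  exact Ideal.Quotient.maximal_of_isField _
    (isField_of_isIntegral_of_isField' (Field.toIsField k))

theorem IsParameterSystem.isRegularSystem (hθ : IsParameterSystem θ)
    (hhom : IsHomogeneousSystem b a θ) : IsRegularSystem θ := by
  set p : Ideal (MvPolynomial (Fin m) k) :=
    RingHom.ker (MvPolynomial.constantCoeff : MvPolynomial (Fin m) k →+* k) with hp
  have hpp : p.IsPrime := RingHom.ker_isPrime _
  let S := Localization.AtPrime p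
  have hX : IsRegular S ((List.ofFn (MvPolynomial.X : Fin m → MvPolynomial (Fin m) k)).map
      (algebraMap _ S)) := by
    refine isWeaklyRegular_X.isRegular_of_isLocalization_of_mem S p ?_
    intro r hr
    obtain ⟨j, rfl⟩ := List.mem_ofFn.1 hr
    rw [hp, RingHom.mem_ker, MvPolynomial.constantCoeff_X]
  have hmem {x} (hx : x ∈ p) : algebraMap _ S x ∈ IsLocalRing.maximalIdeal S :=
    (IsLocalization.AtPrime.to_map_mem_maximal_iff S p x).2 hx
  have hS : IsWeaklyRegular S ((List.ofFn θ).map (algebraMap _ S)) := by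
    refine isWeaklyRegular_of_forall_isPrime_eq_maximalIdeal _ hX ?_ (by simp) ?_ ?_
    · intro r hr
      obtain ⟨x, hx, rfl⟩ := List.mem_map.1 hr
      obtain ⟨j, rfl⟩ := List.mem_ofFn.1 hx
      refine hmem ?_
      rw [hp, RingHom.mem_ker, MvPolynomial.constantCoeff_X]
    · intro r hr
      obtain ⟨x, hx, rfl⟩ := List.mem_map.1 hr
      obtain ⟨j, rfl⟩ := List.mem_ofFn.1 hx
      exact hmem (hhom.constantCoeff_eq_zero j)
    · intro q hq _ hqθ
      -- The contraction of `q` is maximal and contained in `p`, hence equal to `p`.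
      have hmax : (q.comap (algebraMap (MvPolynomial (Fin m) k) S)).IsMaximal := by
        refine hθ.isMaximal hhom.constantCoeff_eq_zero fun j => ?_
        exact hqθ _ (List.mem_map.2 ⟨θ j, List.mem_ofFn.2 ⟨j, rfl⟩, rfl⟩)
      have hle : q.comap (algebraMap (MvPolynomial (Fin m) k) S) ≤ p := by
        intro x hx
        exact (IsLocalization.AtPrime.to_map_mem_maximal_iff S p x).1
          (IsLocalRing.le_maximalIdeal hq.ne_top hx)
      have heq := hmax.eq_of_le hpp.ne_top hle
      rw [← IsLocalization.map_under p.primeCompl S q, Ideal.under_def, heq,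
        IsLocalization.AtPrime.map_eq_maximalIdeal]
  rw [List.map_ofFn, isWeaklyRegular_ofFn_iff] at hS
  unfold IsRegularSystem
  rw [isWeaklyRegular_ofFn_iff]
  intro i f hf
  have hIhom : ∀ x ∈ θ '' Set.Iio i, ∃ d, x.IsWeightedHomogeneous b d := by
    rintro _ ⟨j, -, rfl⟩
    exact ⟨a j, hhom.homogeneous j⟩
  have hmap : Ideal.span ((algebraMap _ S ∘ θ) '' Set.Iio i) =
      (Ideal.span (θ '' Set.Iio i)).map (algebraMap _ S) := by
    rw [Ideal.map_span, Set.image_comp]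
  rw [mem_span_iff_weightedHomogeneousComponent_mem hIhom] at hf ⊢
  intro n
  have hg := hf (n + a i)
  rw [weightedHomogeneousComponent_mul_of_right (hhom.homogeneous i), if_pos (by omega),
    Nat.add_sub_cancel] at hg
  set g := MvPolynomial.weightedHomogeneousComponent b n f
  have hgn : g.IsWeightedHomogeneous b n :=
    MvPolynomial.weightedHomogeneousComponent_isWeightedHomogeneous _ _
  have hgS := hS i (algebraMap _ S g) (by
    rw [hmap, Function.comp_apply, ← map_mul]
    exact Ideal.mem_map_of_mem _ hg)
  rw [hmap] at hgS
  -- The denominator `s` has nonzero constant term, and the degree `n` component of `s * g` is that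
  -- constant times `g`. As the ideal is homogeneous, it contains `g`.
  obtain ⟨s, hs, hsg⟩ := (IsLocalization.algebraMap_mem_map_algebraMap_iff p.primeCompl S _ _).1 hgS
  have hs0 : MvPolynomial.constantCoeff s ≠ 0 := hs
  rw [mem_span_iff_weightedHomogeneousComponent_mem hIhom] at hsg
  have := hsg n
  rw [weightedHomogeneousComponent_mul_same hgn hhom.weight_pos] at this
  have h := Ideal.mul_mem_left _ (MvPolynomial.C (MvPolynomial.constantCoeff s)⁻¹) this
  rwa [← mul_assoc, ← map_mul, inv_mul_cancel₀ hs0, map_one, one_mul] at h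

end Regular

/-! ### Hilbert series of graded quotients -/

section Hilbert

variable {k : Type*} [Field k] {m : ℕ}

/-- The Hilbert series of the quotient of a weighted polynomial ring by an ideal. -/
noncomputable def quotientHilbertSeries (b : Fin m → ℕ) (I : Ideal (MvPolynomial (Fin m) k)) :
    PowerSeries ℤ :=
  PowerSeries.mk fun n => (Module.finrank k ((MvPolynomial.weightedHomogeneousSubmodule k b n).map
    (Ideal.Quotient.mkₐ k I).toLinearMap) : ℤ)

theorem finrank_map_eq_sub {V W : Type*} [AddCommGroup V] [Module k V] [AddCommGroup W]
    [Module k W] (f : V →ₗ[k] W) (p q : Submodule k V) [FiniteDimensional k p]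
    (h : p ⊓ LinearMap.ker f = q) :
    (Module.finrank k (p.map f) : ℤ) = Module.finrank k p - Module.finrank k q := by
  have h1 := (f.domRestrict p).finrank_range_add_finrank_ker
  rw [LinearMap.range_domRestrict, LinearMap.ker_domRestrict] at h1
  have h2 : Module.finrank k ((LinearMap.ker f).comap p.subtype) = Module.finrank k q := by
    rw [← h, ← Submodule.map_comap_subtype]
    exact (Submodule.equivMapOfInjective p.subtype p.injective_subtype _).finrank_eq
  omega

variable {b : Fin m → ℕ}

/-- Multiplication by `t` embeds `P ⧸ I`, shifted by `d`, as the kernel of `P ⧸ I → P ⧸ J`;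
dimensions are compared degree by degree. -/
theorem quotientHilbertSeries_sup_span_singleton (hb : ∀ j, 0 < b j)
    {s : Set (MvPolynomial (Fin m) k)} (hs : ∀ x ∈ s, ∃ d, x.IsWeightedHomogeneous b d)
    {t : MvPolynomial (Fin m) k} {d : ℕ} (ht : t.IsWeightedHomogeneous b d)
    (hreg : ∀ f, f * t ∈ Ideal.span s → f ∈ Ideal.span s) :
    quotientHilbertSeries b (Ideal.span (insert t s)) =
      quotientHilbertSeries b (Ideal.span s) * (1 - PowerSeries.X ^ d) := by
  set I := Ideal.span s with hI
  have hIJ : I ≤ Ideal.span (insert t s) := Ideal.span_mono (Set.subset_insert _ _)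
  set J := Ideal.span (insert t s) with hJ
  let π : (MvPolynomial (Fin m) k ⧸ I) →ₗ[k] (MvPolynomial (Fin m) k ⧸ J) :=
    (Ideal.Quotient.factorₐ k hIJ).toLinearMap
  let μ : (MvPolynomial (Fin m) k ⧸ I) →ₗ[k] (MvPolynomial (Fin m) k ⧸ I) :=
    LinearMap.mulRight k (Ideal.Quotient.mk I t)
  have hμ : Function.Injective μ := by
    rw [injective_iff_map_eq_zero]
    intro y hy
    obtain ⟨f, rfl⟩ := Ideal.Quotient.mk_surjective y
    rw [LinearMap.mulRight_apply, ← map_mul, Ideal.Quotient.eq_zero_iff_mem] at hy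
    rw [Ideal.Quotient.eq_zero_iff_mem]
    exact hreg f hy
  have hfin (n : ℕ) : FiniteDimensional k ((MvPolynomial.weightedHomogeneousSubmodule k b n).map
      (Ideal.Quotient.mkₐ k I).toLinearMap) :=
    Module.Finite.iff_fg.2
      ((MvPolynomial.weightedHomogeneousSubmodule_fg k b (fun j => (hb j).ne') n).map _)
  have hmap (n : ℕ) : (MvPolynomial.weightedHomogeneousSubmodule k b n).map
      (Ideal.Quotient.mkₐ k J).toLinearMap =
      ((MvPolynomial.weightedHomogeneousSubmodule k b n).map
        (Ideal.Quotient.mkₐ k I).toLinearMap).map π := by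
    rw [← Submodule.map_comp]
    rfl
  ext n
  rw [mul_sub, mul_one, map_sub, PowerSeries.coeff_mul_X_pow']
  simp only [quotientHilbertSeries, PowerSeries.coeff_mk]
  rw [hmap]
  split_ifs with hdn
  · rw [finrank_map_eq_sub π _ (((MvPolynomial.weightedHomogeneousSubmodule k b (n - d)).map
      (Ideal.Quotient.mkₐ k I).toLinearMap).map μ),
      ← (Submodule.equivMapOfInjective μ hμ _).finrank_eq]
    apply le_antisymm
    · rintro _ ⟨⟨f, hf, rfl⟩, hker⟩
      have hfJ : f ∈ J := Ideal.Quotient.eq_zero_iff_mem.1 hker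
      rw [hJ, Ideal.span_insert, sup_comm] at hfJ
      obtain ⟨g, hg, _, hh, rfl⟩ := Submodule.mem_sup.1 hfJ
      obtain ⟨h, rfl⟩ := Ideal.mem_span_singleton'.1 hh
      -- In `f = g + h * t` only the degree `n - d` component of `h` matters.
      refine ⟨_, ⟨_, MvPolynomial.weightedHomogeneousComponent_mem b h (n - d), rfl⟩, ?_⟩
      have heq := MvPolynomial.weightedHomogeneousComponent_eq_self hf
      rw [map_add, weightedHomogeneousComponent_mul_of_right ht, if_pos hdn] at heq
      rw [← heq]
      have hgn := (mem_span_iff_weightedHomogeneousComponent_mem hs).1 hg n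
      change Ideal.Quotient.mk I _ * Ideal.Quotient.mk I t = Ideal.Quotient.mk I _
      rw [map_add, Ideal.Quotient.eq_zero_iff_mem.2 hgn, zero_add, map_mul]
    · rintro _ ⟨_, ⟨f, hf, rfl⟩, rfl⟩
      refine ⟨⟨f * t, ?_, map_mul (Ideal.Quotient.mkₐ k I) _ _⟩, ?_⟩
      · have := MvPolynomial.IsWeightedHomogeneous.mul hf ht
        rwa [Nat.sub_add_cancel hdn] at this
      · refine Ideal.Quotient.eq_zero_iff_mem.2 ?_
        exact Ideal.mul_mem_left _ _ (Ideal.subset_span (Set.mem_insert _ _))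
  · rw [finrank_map_eq_sub π _ ⊥, finrank_bot, Nat.cast_zero]
    rw [eq_bot_iff]
    rintro _ ⟨⟨f, hf, rfl⟩, hker⟩
    have hfJ : f ∈ J := Ideal.Quotient.eq_zero_iff_mem.1 hker
    rw [hJ, Ideal.span_insert, sup_comm] at hfJ
    obtain ⟨g, hg, _, hh, rfl⟩ := Submodule.mem_sup.1 hfJ
    obtain ⟨h, rfl⟩ := Ideal.mem_span_singleton'.1 hh
    have heq := MvPolynomial.weightedHomogeneousComponent_eq_self hf
    rw [map_add, weightedHomogeneousComponent_mul_of_right ht, if_neg hdn, add_zero] at heq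
    rw [← heq]
    exact Ideal.Quotient.eq_zero_iff_mem.2
      ((mem_span_iff_weightedHomogeneousComponent_mem hs).1 hg n)

theorem quotientHilbertSeries_span_range (hb : ∀ j, 0 < b j) {a : Fin m → ℕ}
    {θ : Fin m → MvPolynomial (Fin m) k} (hθ : ∀ j, (θ j).IsWeightedHomogeneous b (a j))
    (hreg : RingTheory.Sequence.IsWeaklyRegular (MvPolynomial (Fin m) k) (List.ofFn θ)) :
    quotientHilbertSeries b (Ideal.span (Set.range θ)) =
      quotientHilbertSeries b (⊥ : Ideal (MvPolynomial (Fin m) k)) *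
        ∏ j, (1 - PowerSeries.X ^ a j) := by
  rw [isWeaklyRegular_ofFn_iff] at hreg
  have key (i : ℕ) (hi : i ≤ m) :
      quotientHilbertSeries b (Ideal.span (θ '' {j | (j : ℕ) < i})) =
        quotientHilbertSeries b (⊥ : Ideal (MvPolynomial (Fin m) k)) *
          ∏ j ∈ Finset.univ.filter (fun j : Fin m => (j : ℕ) < i), (1 - PowerSeries.X ^ a j) := by
    induction i with
    | zero => simp
    | succ i ih =>
      have h1 : {j : Fin m | (j : ℕ) < i + 1} = insert ⟨i, hi⟩ {j : Fin m | (j : ℕ) < i} := by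
        ext j
        simp only [Set.mem_ofPred_eq, Set.mem_insert_iff, Fin.ext_iff]
        omega
      have h2 : ({j | (j : ℕ) < i + 1} : Finset (Fin m)) =
          insert ⟨i, hi⟩ ({j | (j : ℕ) < i} : Finset (Fin m)) := by
        ext j
        simp only [Finset.mem_filter, Finset.mem_univ, true_and, Finset.mem_insert, Fin.ext_iff]
        omega
      have hIio : {j : Fin m | (j : ℕ) < i} = Set.Iio ⟨i, hi⟩ := rfl
      rw [hIio] at h1 ih
      rw [h1, h2, Set.image_insert_eq, Finset.prod_insert (by simp),
        quotientHilbertSeries_sup_span_singleton hb _ (hθ ⟨i, hi⟩) (hreg ⟨i, hi⟩),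
        mul_comm (1 - _), ← mul_assoc]
      · congr 1
        exact ih (by omega)
      · rintro _ ⟨j, -, rfl⟩
        exact ⟨_, hθ j⟩
  have h := key m le_rfl
  simpa using h

theorem quotientHilbertSeries_span_X (hb : ∀ j, 0 < b j) :
    quotientHilbertSeries b (Ideal.span (Set.range
      (MvPolynomial.X : Fin m → MvPolynomial (Fin m) k))) = 1 := by
  set I := Ideal.span (Set.range (MvPolynomial.X : Fin m → MvPolynomial (Fin m) k)) with hI
  have hmem (f : MvPolynomial (Fin m) k) : f ∈ I ↔ MvPolynomial.constantCoeff f = 0 := by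
    rw [hI, ← Set.image_univ, MvPolynomial.mem_ideal_span_X_image, MvPolynomial.constantCoeff_eq,
      ← MvPolynomial.notMem_support_iff]
    constructor
    · intro h h0
      obtain ⟨i, -, hi⟩ := h 0 h0
      exact hi rfl
    · intro h d hd
      by_contra hcon
      push Not at hcon
      have : d = 0 := by
        ext i
        exact hcon i trivial
      exact h (this ▸ hd)
  ext n
  rw [quotientHilbertSeries, PowerSeries.coeff_mk, PowerSeries.coeff_one]
  split_ifs with hn
  · subst hn
    have : (MvPolynomial.weightedHomogeneousSubmodule k b 0).map
        (Ideal.Quotient.mkₐ k I).toLinearMap = Submodule.span k {1} := by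
      apply le_antisymm
      · rintro _ ⟨f, hf, rfl⟩
        refine Submodule.mem_span_singleton.2 ⟨MvPolynomial.constantCoeff f, ?_⟩
        have hf' := MvPolynomial.weightedHomogeneousComponent_eq_self hf
        rw [MvPolynomial.weightedHomogeneousComponent_zero _ fun i => (hb i).ne'] at hf'
        conv_rhs => rw [← hf']
        rw [Algebra.smul_def, mul_one]
        rfl
      · rw [Submodule.span_singleton_le_iff_mem]
        exact ⟨1, MvPolynomial.isWeightedHomogeneous_one k b, map_one (Ideal.Quotient.mkₐ k I)⟩
    rw [this, finrank_span_singleton, Nat.cast_one]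
    intro h1
    have h2 : (1 : MvPolynomial (Fin m) k) ∈ I := Ideal.Quotient.eq_zero_iff_mem.1 h1
    rw [hmem, map_one] at h2
    exact one_ne_zero h2
  · have : (MvPolynomial.weightedHomogeneousSubmodule k b n).map
        (Ideal.Quotient.mkₐ k I).toLinearMap = ⊥ := by
      rw [eq_bot_iff]
      rintro _ ⟨f, hf, rfl⟩
      refine Ideal.Quotient.eq_zero_iff_mem.2 ((hmem f).2 ?_)
      exact constantCoeff_eq_zero_of_isWeightedHomogeneous hf (Nat.pos_of_ne_zero hn)
    rw [this, finrank_bot, Nat.cast_zero]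

variable {a : Fin m → ℕ} {θ : Fin m → MvPolynomial (Fin m) k}

theorem IsRegularSystem.hilbertSeries_mul_prod (hreg : IsRegularSystem θ)
    (hθ : IsHomogeneousSystem b a θ) :
    hilbertSeries b θ * ∏ j, (1 - PowerSeries.X ^ b j) = ∏ j, (1 - PowerSeries.X ^ a j) := by
  have h1 := quotientHilbertSeries_span_range hθ.weight_pos hθ.homogeneous hreg
  -- Taking the variables as the regular sequence, with quotient `k`, inverts the series of the
  -- polynomial ring without counting monomials.
  have h2 := quotientHilbertSeries_span_range (k := k) hθ.weight_pos
    (fun j => MvPolynomial.isWeightedHomogeneous_X k b j) isWeaklyRegular_X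
  rw [quotientHilbertSeries_span_X hθ.weight_pos] at h2
  change quotientHilbertSeries b (Ideal.span (Set.range θ)) * _ = _
  rw [h1, mul_right_comm, ← h2, one_mul]

theorem qInt_mul_one_sub_X (n : ℕ) :
    (qInt n : PowerSeries ℤ) * (1 - PowerSeries.X) = 1 - PowerSeries.X ^ n := by
  have h : qInt n * (1 - X) = 1 - X ^ n := by
    rw [qInt, mul_comm, mul_neg_geom_sum]
  have h' := congrArg (fun f : ℤ[X] => (f : PowerSeries ℤ)) h
  simpa using h'

theorem prod_one_sub_X_pow_eq (c : Fin m → ℕ) :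
    ∏ j, (1 - PowerSeries.X ^ c j : PowerSeries ℤ) =
      ((∏ j, qInt (c j) : ℤ[X]) : PowerSeries ℤ) * (1 - PowerSeries.X) ^ m := by
  have : (1 - PowerSeries.X : PowerSeries ℤ) ^ m = ∏ _j : Fin m, (1 - PowerSeries.X) := by simp
  rw [this, ← Polynomial.coeToPowerSeries.ringHom_apply, map_prod, ← Finset.prod_mul_distrib]
  exact Finset.prod_congr rfl fun j _ => (qInt_mul_one_sub_X _).symm

theorem one_sub_X_ne_zero : (1 - PowerSeries.X : PowerSeries ℤ) ≠ 0 := fun h => by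
  have := congrArg PowerSeries.constantCoeff h
  simp at this

theorem IsRegularSystem.hilbertSeries_mul_prod_qInt (hreg : IsRegularSystem θ)
    (hθ : IsHomogeneousSystem b a θ) :
    hilbertSeries b θ * ((∏ j, qInt (b j) : ℤ[X]) : PowerSeries ℤ) =
      ((∏ j, qInt (a j) : ℤ[X]) : PowerSeries ℤ) := by
  have h := hreg.hilbertSeries_mul_prod hθ
  rw [prod_one_sub_X_pow_eq, prod_one_sub_X_pow_eq, ← mul_assoc] at h
  exact mul_right_cancel₀ (pow_ne_zero _ one_sub_X_ne_zero) h

theorem prod_qInt_coeff_nonneg (c : Fin m → ℕ) (n : ℕ) : 0 ≤ (∏ j, qInt (c j)).coeff n := by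
  refine Finset.prod_induction (fun j => qInt (c j)) (fun f : ℤ[X] => ∀ n, 0 ≤ f.coeff n)
    (fun _ _ => coeff_mul_nonneg) coeff_one_nonneg (fun j _ n => ?_) n
  rw [qInt, Polynomial.finsetSum_coeff]
  exact Finset.sum_nonneg fun i _ => by rw [Polynomial.coeff_X_pow]; split_ifs <;> simp

theorem prod_qInt_coeff_zero {c : Fin m → ℕ} (hc : ∀ j, 0 < c j) :
    (∏ j, qInt (c j)).coeff 0 = 1 := by
  rw [Polynomial.coeff_zero_prod]
  refine Finset.prod_eq_one fun j _ => ?_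
  rw [qInt, Polynomial.finsetSum_coeff, Finset.sum_eq_single 0] <;>
    simp +contextual [Polynomial.coeff_X_pow, hc j, eq_comm]

/-- The Hilbert series of a quotient by a homogeneous regular sequence is a polynomial, given by
the expected quotient of products of `q`-integers. -/
theorem IsRegularSystem.exists_hilbertSeries_eq (hreg : IsRegularSystem θ)
    (hθ : IsHomogeneousSystem b a θ) :
    ∃ f : ℤ[X], (f : PowerSeries ℤ) = hilbertSeries b θ ∧ (∀ n, 0 ≤ f.coeff n) ∧
      IsRationalForm f (Finset.univ.val.map a) (Finset.univ.val.map b) := by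
  have h := hreg.hilbertSeries_mul_prod_qInt hθ
  have hnn (n : ℕ) : 0 ≤ (hilbertSeries b θ).coeff n := by
    rw [hilbertSeries, PowerSeries.coeff_mk]
    exact Nat.cast_nonneg _
  -- The denominator has nonnegative coefficients and constant term 1, so multiplying by it can only
  -- increase coefficients.
  have hle (n : ℕ) : (hilbertSeries b θ).coeff n ≤ (∏ j, qInt (a j)).coeff n := by
    rw [← Polynomial.coeff_coe, ← h, PowerSeries.coeff_mul]
    have hmem : (n, 0) ∈ Finset.HasAntidiagonal.antidiagonal n := by simp
    refine le_trans (le_of_eq ?_) (Finset.single_le_sum (fun x _ => mul_nonneg (hnn x.1) ?_) hmem)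
    · rw [Polynomial.coeff_coe, prod_qInt_coeff_zero hθ.weight_pos, mul_one]
    · rw [Polynomial.coeff_coe]
      exact prod_qInt_coeff_nonneg b _
  set N := (∏ j, qInt (a j)).natDegree + 1
  have hf : ((hilbertSeries b θ).trunc N : PowerSeries ℤ) = hilbertSeries b θ := by
    ext n
    rw [Polynomial.coeff_coe, PowerSeries.coeff_trunc]
    split_ifs with hn
    · rfl
    · refine le_antisymm (hnn n) ((hle n).trans_eq ?_)
      exact Polynomial.coeff_eq_zero_of_natDegree_lt (by omega)
  refine ⟨_, hf, fun n => ?_, by simp, by simpa using hθ.degree_pos, by simpa using hθ.weight_pos,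
    ?_⟩
  · rw [← Polynomial.coeff_coe, hf]
    exact hnn n
  · apply Polynomial.coe_injective ℤ
    rw [Polynomial.coe_mul, hf, Multiset.map_map, Multiset.map_map]
    exact h

end Hilbert

/-! ### Comparison of degrees -/

section Degrees

variable {k : Type*} [Field k] {m : ℕ} {b a : Fin m → ℕ} {θ : Fin m → MvPolynomial (Fin m) k}

/-- Counting at `t = y` finds an entry of the first list at most `y`, so its head is too. For the
tails, a threshold `t ≥ y` drops one from both counts, and a smaller one counts nothing in `l₂`. -/
theorem forall₂_le_of_countP_le : ∀ {l₁ l₂ : List ℕ}, l₁.length = l₂.length →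
    l₁.Pairwise (· ≤ ·) → l₂.Pairwise (· ≤ ·) →
    (∀ t, l₂.countP (· ≤ t) ≤ l₁.countP (· ≤ t)) → List.Forall₂ (fun a b : ℕ => a ≤ b) l₁ l₂
  | [], [], _, _, _, _ => .nil
  | x :: l₁, y :: l₂, hl, h₁, h₂, h => by
    have hxy : x ≤ y := by
      have h0 : 0 < (x :: l₁).countP (· ≤ y) := (by simp : 0 < _).trans_le (h y)
      obtain ⟨z, hz, hzy⟩ := List.countP_pos_iff.1 h0
      have hzy' : z ≤ y := by simpa using hzy
      rcases List.mem_cons.1 hz with rfl | hz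
      · exact hzy'
      · exact (List.rel_of_pairwise_cons h₁ hz).trans hzy'
    refine .cons hxy (forall₂_le_of_countP_le (by simpa using hl) h₁.of_cons h₂.of_cons fun t => ?_)
    by_cases hyt : y ≤ t
    · have := h t
      simpa [List.countP_cons, hyt, hxy.trans hyt] using this
    · rw [List.countP_eq_zero.2]
      · exact Nat.zero_le _
      · intro z hz
        have := List.rel_of_pairwise_cons h₂ hz
        simp only [decide_eq_true_eq]
        omega

theorem galeLE_of_card_filter_le
    (h : ∀ t, (Finset.univ.filter fun j => a j ≤ t).card ≤
      (Finset.univ.filter fun j => b j ≤ t).card) :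
    GaleLE (Finset.univ.val.map b) (Finset.univ.val.map a) := by
  have hcount (c : Fin m → ℕ) (t : ℕ) :
      ((Finset.univ.val.map c).sort (· ≤ ·)).countP (· ≤ t) =
        (Finset.univ.filter fun j => c j ≤ t).card := by
    rw [← Multiset.coe_countP, Multiset.sort_eq, Multiset.countP_map]
    rfl
  refine forall₂_le_of_countP_le (by simp) (Multiset.pairwise_sort _ _)
    (Multiset.pairwise_sort _ _) fun t => ?_
  rw [hcount, hcount]
  exact h t

theorem isIntegral_adjoin_map {P Q : Type*} [CommRing P] [CommRing Q] [Algebra k P] [Algebra k Q]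
    (φ : P →ₐ[k] Q) {s : Set P} {t : Set Q} (h : ∀ x ∈ s, φ x ∈ Algebra.adjoin k t) {f : P}
    (hf : IsIntegral (Algebra.adjoin k s) f) : IsIntegral (Algebra.adjoin k t) (φ f) := by
  have hle : Algebra.adjoin k s ≤ (Algebra.adjoin k t).comap φ := Algebra.adjoin_le h
  refine hf.map_of_comp_eq
    ((φ.comp (Algebra.adjoin k s).val).codRestrict (Algebra.adjoin k t)
      fun x => hle x.2).toRingHom (φ : P →+* Q) ?_
  ext x
  rfl

theorem IsParameterSystem.card_filter_le (hpar : IsParameterSystem θ)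
    (hθ : IsHomogeneousSystem b a θ) (t : ℕ) :
    (Finset.univ.filter fun j => a j ≤ t).card ≤ (Finset.univ.filter fun j => b j ≤ t).card := by
  classical
  let σ := {i : Fin m // t < b i}
  let φ : MvPolynomial (Fin m) k →ₐ[k] MvPolynomial σ k :=
    MvPolynomial.aeval fun i => if h : t < b i then MvPolynomial.X ⟨i, h⟩ else 0
  have hφX (i : σ) : φ (MvPolynomial.X i.1) = MvPolynomial.X i := by
    simp [φ, i.2]
  have hφsurj (y : MvPolynomial σ k) : φ (MvPolynomial.rename Subtype.val y) = y := by
    have : φ.comp (MvPolynomial.rename Subtype.val) = AlgHom.id k (MvPolynomial σ k) := by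
      ext i : 1
      rw [AlgHom.comp_apply, MvPolynomial.rename_X, hφX]
      rfl
    exact DFunLike.congr_fun this y
  have hφθ (j : Fin m) (hj : a j ≤ t) : φ (θ j) = 0 := by
    rw [MvPolynomial.as_sum (θ j), map_sum]
    refine Finset.sum_eq_zero fun d hd => ?_
    have hw := hθ.homogeneous j (MvPolynomial.mem_support_iff.1 hd)
    have hd0 : d ≠ 0 := by
      rintro rfl
      rw [map_zero] at hw
      exact (hθ.degree_pos j).ne hw
    obtain ⟨i, hi⟩ := Finsupp.ne_iff.1 hd0
    -- A nonconstant monomial of degree at most `t` involves only variables of degree at most `t`,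
    -- all sent to 0.
    have hbi : b i ≤ t := (Finsupp.le_weight_of_ne_zero' b hi).trans (hw.le.trans hj)
    rw [MvPolynomial.aeval_monomial, Finsupp.prod,
      Finset.prod_eq_zero (Finsupp.mem_support_iff.2 hi), mul_zero]
    rw [dif_neg (by omega), zero_pow hi]
  let s : Set (MvPolynomial σ k) := Set.range fun j : {j : Fin m // t < a j} => φ (θ j.1)
  unfold IsParameterSystem at hpar
  have hint := Algebra.IsIntegral.of_finite (Algebra.adjoin k (Set.range θ))
    (MvPolynomial (Fin m) k)
  have : Algebra.IsIntegral (Algebra.adjoin k s) (MvPolynomial σ k) := by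
    refine ⟨fun y => ?_⟩
    rw [← hφsurj y]
    refine isIntegral_adjoin_map φ ?_ (hint.isIntegral _)
    rintro _ ⟨j, rfl⟩
    by_cases hj : a j ≤ t
    · rw [hφθ j hj]
      exact zero_mem _
    · exact Algebra.subset_adjoin ⟨⟨j, by omega⟩, rfl⟩
  have : Algebra.IsAlgebraic (Algebra.adjoin k s) (MvPolynomial σ k) := inferInstance
  have h1 := Algebra.IsAlgebraic.trdeg_le_cardinalMk k s
  rw [MvPolynomial.trdeg_of_isDomain] at h1
  have h2 := Cardinal.mk_range_le_lift (f := fun j : {j : Fin m // t < a j} => φ (θ j.1))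
  have h3 := (Cardinal.lift_le.2 h1).trans h2
  have h4 : Fintype.card σ ≤ Fintype.card {j : Fin m // t < a j} := by
    simpa using h3
  rw [Fintype.card_subtype, Fintype.card_subtype] at h4
  have h5 := Finset.card_filter_add_card_filter_not (s := Finset.univ) fun j => a j ≤ t
  have h6 := Finset.card_filter_add_card_filter_not (s := Finset.univ) fun j => b j ≤ t
  simp only [not_le] at h5 h6
  omega

theorem IsRegularSystem.isParameterSystem (hreg : IsRegularSystem θ)
    (hθ : IsHomogeneousSystem b a θ) : IsParameterSystem θ := by
  have hfg := MvPolynomial.weightedHomogeneousSubmodule_fg k b fun j => (hθ.weight_pos j).ne'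
  obtain ⟨f, hf, -, -⟩ := hreg.exists_hilbertSeries_eq hθ
  have hle (n : ℕ) (hn : f.natDegree < n) {g : MvPolynomial (Fin m) k}
      (hg : g.IsWeightedHomogeneous b n) : g ∈ Ideal.span (Set.range θ) := by
    have h0 : Module.finrank k (gradedPiece b θ n) = 0 := by
      have := congrArg (PowerSeries.coeff n) hf
      rw [Polynomial.coeff_coe, Polynomial.coeff_eq_zero_of_natDegree_lt hn, hilbertSeries,
        PowerSeries.coeff_mk] at this
      exact_mod_cast this.symm
    have : Module.Finite k (gradedPiece b θ n) := Module.Finite.iff_fg.2 ((hfg n).map _)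
    rw [Submodule.finrank_eq_zero] at h0
    refine Ideal.Quotient.eq_zero_iff_mem.1 ((Submodule.mem_bot k).1 ?_)
    rw [← h0]
    exact ⟨g, hg, rfl⟩
  choose G hG using hfg
  classical
  set A := Algebra.adjoin k (Set.range θ)
  -- Finite spanning sets of the degrees up to `f.natDegree` generate: any higher form is `∑ c_j *
  -- θ_j`, with `c_j` replaceable by its component of degree `n - a j < n`.
  set N : Submodule A (MvPolynomial (Fin m) k) :=
    Submodule.span A ((Finset.range (f.natDegree + 1)).biUnion G) with hN
  have key (n : ℕ) : ∀ g : MvPolynomial (Fin m) k, g.IsWeightedHomogeneous b n → g ∈ N := by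
    induction n using Nat.strong_induction_on with
    | _ n ih =>
      intro g hg
      by_cases hn : f.natDegree < n
      · obtain ⟨c, hc⟩ := Ideal.mem_span_range_iff_exists_fun.1 (hle n hn hg)
        rw [← MvPolynomial.weightedHomogeneousComponent_eq_self hg, ← hc, map_sum]
        refine Submodule.sum_mem _ fun j _ => ?_
        rw [weightedHomogeneousComponent_mul_of_right (hθ.homogeneous j)]
        split_ifs with hj
        · have hpos := hθ.degree_pos j
          have := N.smul_mem (⟨θ j, Algebra.subset_adjoin ⟨j, rfl⟩⟩ : A)
            (ih (n - a j) (by omega) _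
              (MvPolynomial.weightedHomogeneousComponent_isWeightedHomogeneous _ (c j)))
          rwa [Subalgebra.smul_def, smul_eq_mul, mul_comm] at this
        · exact N.zero_mem
      · have hle' : MvPolynomial.weightedHomogeneousSubmodule k b n ≤ N.restrictScalars k := by
          rw [← hG n, Submodule.span_le]
          intro x hx
          refine Submodule.subset_span ?_
          rw [Finset.mem_coe, Finset.mem_biUnion]
          exact ⟨n, Finset.mem_range.2 (by omega), hx⟩
        exact hle' hg
  refine ⟨⟨_, (hN.symm.trans ?_ : Submodule.span A _ = ⊤)⟩⟩
  rw [eq_top_iff]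
  intro g _
  induction g using MvPolynomial.induction_on' with
  | monomial d c => exact key _ _ (MvPolynomial.isWeightedHomogeneous_monomial b d c rfl)
  | add p q hp hq => exact N.add_mem (hp trivial) (hq trivial)

end Degrees

/-! ### Products -/

section Products

variable {k : Type*} [Field k] {m : ℕ} {b a : Fin m → ℕ} {θ : Fin m → MvPolynomial (Fin m) k}

/-- An integral algebra of finite type is a finite module, and integrality can be tested on
generators. -/
theorem isParameterSystem_of_isIntegral_X
    (h : ∀ i, IsIntegral (Algebra.adjoin k (Set.range θ))
      (MvPolynomial.X i : MvPolynomial (Fin m) k)) : IsParameterSystem θ := by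
  have h1 : Algebra.IsIntegral (Algebra.adjoin k (Set.range θ)) (MvPolynomial (Fin m) k) := by
    refine ⟨fun f => ?_⟩
    induction f using MvPolynomial.induction_on with
    | C r =>
      exact isIntegral_algebraMap (x := algebraMap k (Algebra.adjoin k (Set.range θ)) r)
    | add p q hp hq => exact hp.add hq
    | mul_X p i hp => exact hp.mul (h i)
  have h2 : Algebra.FiniteType (Algebra.adjoin k (Set.range θ)) (MvPolynomial (Fin m) k) :=
    Algebra.FiniteType.of_restrictScalars_finiteType k _ _
  exact Algebra.IsIntegral.finite

theorem isWeightedHomogeneous_rename {σ τ : Type*} {e : σ → τ} {w : τ → ℕ} {w' : σ → ℕ}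
    (hw : ∀ i, w (e i) = w' i) {φ : MvPolynomial σ k} {d : ℕ}
    (hφ : φ.IsWeightedHomogeneous w' d) : (MvPolynomial.rename e φ).IsWeightedHomogeneous w d := by
  intro u hu
  obtain ⟨v, rfl, hv⟩ := MvPolynomial.coeff_rename_ne_zero _ _ _ hu
  rw [← hφ hv, Finsupp.weight, Finsupp.weight, LinearMap.toAddMonoidHom_coe,
    LinearMap.toAddMonoidHom_coe, Finsupp.linearCombination_mapDomain]
  congr 2
  exact funext hw

variable {n : ℕ} {b' a' : Fin n → ℕ} {θ' : Fin n → MvPolynomial (Fin n) k}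

/-- The concatenation of two systems of polynomials in disjoint sets of variables. -/
noncomputable def appendSystem (θ : Fin m → MvPolynomial (Fin m) k)
    (θ' : Fin n → MvPolynomial (Fin n) k) : Fin (m + n) → MvPolynomial (Fin (m + n)) k :=
  Fin.append (fun i => MvPolynomial.rename (Fin.castAdd n) (θ i))
    (fun i => MvPolynomial.rename (Fin.natAdd m) (θ' i))

theorem IsHomogeneousSystem.append (h : IsHomogeneousSystem b a θ)
    (h' : IsHomogeneousSystem b' a' θ') :
    IsHomogeneousSystem (Fin.append b b') (Fin.append a a') (appendSystem θ θ') where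
  weight_pos j := by
    refine Fin.addCases (fun i => ?_) (fun i => ?_) j
    · simpa using h.weight_pos i
    · simpa using h'.weight_pos i
  degree_pos j := by
    refine Fin.addCases (fun i => ?_) (fun i => ?_) j
    · simpa using h.degree_pos i
    · simpa using h'.degree_pos i
  homogeneous j := by
    refine Fin.addCases (fun i => ?_) (fun i => ?_) j
    · rw [appendSystem, Fin.append_left, Fin.append_left]
      exact isWeightedHomogeneous_rename (by simp) (h.homogeneous i)
    · rw [appendSystem, Fin.append_right, Fin.append_right]
      exact isWeightedHomogeneous_rename (by simp) (h'.homogeneous i)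

theorem IsParameterSystem.append (h : IsParameterSystem θ) (h' : IsParameterSystem θ') :
    IsParameterSystem (appendSystem θ θ') := by
  unfold IsParameterSystem at h h'
  have hint := Algebra.IsIntegral.of_finite (Algebra.adjoin k (Set.range θ))
    (MvPolynomial (Fin m) k)
  have hint' := Algebra.IsIntegral.of_finite (Algebra.adjoin k (Set.range θ'))
    (MvPolynomial (Fin n) k)
  refine isParameterSystem_of_isIntegral_X fun j => ?_
  refine Fin.addCases (fun i => ?_) (fun i => ?_) j
  · rw [← MvPolynomial.rename_X (R := k) (Fin.castAdd n) i]
    refine isIntegral_adjoin_map _ ?_ (hint.isIntegral _)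
    rintro _ ⟨l, rfl⟩
    exact Algebra.subset_adjoin ⟨Fin.castAdd n l, Fin.append_left _ _ _⟩
  · rw [← MvPolynomial.rename_X (R := k) (Fin.natAdd m) i]
    refine isIntegral_adjoin_map _ ?_ (hint'.isIntegral _)
    rintro _ ⟨l, rfl⟩
    exact Algebra.subset_adjoin ⟨Fin.natAdd m l, Fin.append_right _ _ _⟩

theorem prod_qInt_ne_zero {c : Fin m → ℕ} (hc : ∀ j, 0 < c j) :
    ((∏ j, qInt (c j) : ℤ[X]) : PowerSeries ℤ) ≠ 0 := by
  intro h
  have := congrArg (PowerSeries.coeff 0) h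
  rw [Polynomial.coeff_coe, prod_qInt_coeff_zero hc] at this
  simp at this

/-- Both sides have the same product with the nonzero denominator `∏ [b_j]_q ∏ [b'_j]_q`, so no
tensor product decomposition is needed. -/
theorem hilbertSeries_append (h : IsHomogeneousSystem b a θ) (hpar : IsParameterSystem θ)
    (h' : IsHomogeneousSystem b' a' θ') (hpar' : IsParameterSystem θ') :
    hilbertSeries (Fin.append b b') (appendSystem θ θ') =
      hilbertSeries b θ * hilbertSeries b' θ' := by
  have e := (hpar.isRegularSystem h).hilbertSeries_mul_prod_qInt h
  have e' := (hpar'.isRegularSystem h').hilbertSeries_mul_prod_qInt h'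
  have e'' := ((hpar.append hpar').isRegularSystem (h.append h')).hilbertSeries_mul_prod_qInt
    (h.append h')
  refine mul_right_cancel₀ (prod_qInt_ne_zero (h.append h').weight_pos) (e''.trans ?_)
  rw [Fin.prod_univ_add, Fin.prod_univ_add]
  simp only [Fin.append_left, Fin.append_right, Polynomial.coe_mul]
  rw [← e, ← e']
  ring

theorem isHomogeneousSystem_zero : IsHomogeneousSystem (k := k) (m := 0) 0 0 0 :=
  ⟨fun j => j.elim0, fun j => j.elim0, fun j => j.elim0⟩

theorem isParameterSystem_zero : IsParameterSystem (k := k) (m := 0) 0 :=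
  isParameterSystem_of_isIntegral_X fun j => j.elim0

theorem hilbertSeries_zero : hilbertSeries (k := k) (m := 0) 0 0 = 1 := by
  simpa using (isParameterSystem_zero (k := k).isRegularSystem
    isHomogeneousSystem_zero).hilbertSeries_mul_prod_qInt isHomogeneousSystem_zero

/-- The monoid of polynomials that are Hilbert series of quotients by homogeneous systems of
parameters. -/
def hsopMonoid (k : Type*) [Field k] : Submonoid ℤ[X] where
  carrier := {f | (f : PowerSeries ℤ) ∈ hsopHilbertSeries k}
  one_mem' := ⟨0, 0, 0, 0, isHomogeneousSystem_zero, isParameterSystem_zero, by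
    rw [hilbertSeries_zero, Polynomial.coe_one]⟩
  mul_mem' := by
    rintro f g ⟨m, b, a, θ, h, hpar, hf⟩ ⟨n, b', a', θ', h', hpar', hg⟩
    exact ⟨m + n, _, _, _, h.append h', hpar.append hpar', by
      rw [Polynomial.coe_mul, hf, hg, hilbertSeries_append h hpar h' hpar']⟩

theorem exists_mem_galeMonoid (hθ : IsHomogeneousSystem b a θ) (hpar : IsParameterSystem θ) :
    ∃ f ∈ galeMonoid, (f : PowerSeries ℤ) = hilbertSeries b θ := by
  obtain ⟨f, hf, hnn, hrat⟩ := (hpar.isRegularSystem hθ).exists_hilbertSeries_eq hθ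
  exact ⟨f, ⟨⟨hnn, _, _, hrat⟩, _, _, hrat, galeLE_of_card_filter_le (hpar.card_filter_le hθ)⟩, hf⟩

end Products

theorem mainTheorem12 (k : Type*) [Field k] :
    -- the Hilbert series of quotients by homogeneous systems of parameters are polynomials and
    -- form a submonoid of the Gale monoid
    (∃ S : Submonoid ℤ[X],
      (fun f : ℤ[X] => (f : PowerSeries ℤ)) '' (S : Set ℤ[X]) = hsopHilbertSeries k ∧
      S ≤ galeMonoid) ∧
    -- the same for an individual homogeneous regular sequence (or system of parameters), together
    -- with the inequalities `b_k ≤ a_k` between the sorted degrees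
    ∀ (m : ℕ) (b a : Fin m → ℕ) (θ : Fin m → MvPolynomial (Fin m) k),
      IsHomogeneousSystem b a θ → (IsRegularSystem θ ∨ IsParameterSystem θ) →
      (∃ f ∈ galeMonoid, (f : PowerSeries ℤ) = hilbertSeries b θ) ∧
      GaleLE (Finset.univ.val.map b) (Finset.univ.val.map a) := by
  refine ⟨⟨hsopMonoid k, ?_, ?_⟩, ?_⟩
  · ext F
    constructor
    · rintro ⟨f, hf, rfl⟩
      exact hf
    · rintro ⟨m, b, a, θ, hθ, hpar, rfl⟩
      obtain ⟨f, -, hf⟩ := exists_mem_galeMonoid hθ hpar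
      exact ⟨f, ⟨m, b, a, θ, hθ, hpar, hf⟩, hf⟩
  · rintro f ⟨m, b, a, θ, hθ, hpar, hf⟩
    obtain ⟨g, hg, hgf⟩ := exists_mem_galeMonoid hθ hpar
    -- A polynomial is determined by its power series, so `f` is the Gale element `g`.
    rwa [Polynomial.coe_injective ℤ (hf.trans hgf.symm)]
  · intro m b a θ hθ h
    have hpar : IsParameterSystem θ := h.elim (fun hreg => hreg.isParameterSystem hθ) id
    exact ⟨exists_mem_galeMonoid hθ hpar, galeLE_of_card_filter_le (hpar.card_filter_le hθ)⟩
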